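/- Let $A$ be an arbitrary (not necessarily unital) $C^*$-algebra and let $X$ be a (right) Hilbert $A$-module, with inner product $\langle\cdot,\cdot\rangle$ linear in the second variable. For $x,y\in X$ let $\theta_{y,x}$ be the adjointable operator $\theta_{y,x}(z)=y\langle x,z\rangle$ on $X$, and let $\mathbb K(X)$ be the $C^*$-algebra of generalized compact operators, i.e. the norm closure of the linear span of all $\theta_{y,x}$ in the $C^*$-algebra of adjointable operators on $X$. Let $(E_N)_{N\ge 1}$ be an increasing approximate unit for $\mathbb K(X)$, i.e. a sequence in $\mathbb K(X)$ with $0\le E_N\le E_{N+1}$ and $\|E_N\|\le 1$ for all $N$, and $\lim_{N\to\infty}\|E_NT-T\|=0$ for all $T\in\mathbb K(X)$. (a) There exist a sequence $(x_n)_{n\ge1}$ in $X$ and a strictly increasing sequence $(p(N))_{N\ge 1}$ of positive integers such that, for all $N\ge 1$, $$\sum_{n=1}^{p(N)}\theta_{x_n,x_n}\le E_N\quad\text{and}\quad \Big\|\sum_{n=1}^{p(N)}\theta_{x_n,x_n}-E_N\Big\|<\frac1N .$$ (b) If $(x_n)_{n\ge1}$ is any sequence in $X$ for which there is a strictly increasing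 sequence $(p(N))_{N\ge 1}$ of positive integers with the properties in (a), then $(x_n)_n$ is a Parseval frame for $X$, i.e. $\sum_{n=1}^{\infty}\langle x,x_n\rangle\langle x_n,x\rangle=\langle x,x\rangle$ for all $x\in X$, with convergence in norm. -/

import Mathlib

open scoped RightActions
open Filter Topology

/-- A (right) Hilbert C⋆-module over a C⋆-algebra `A`: a complex vector space `X` with a right
action `x <• a` of `A` and an `A`-valued inner product, linear in the second variable, whose norm
is `‖x‖ = ‖⟪x, x⟫‖ ^ (1/2)`. Completeness is the separate type class `CompleteSpace X`. -/
class HilbertModule (A X : Type*) [NonUnitalCStarAlgebra A] [PartialOrder A]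
    [NormedAddCommGroup X] [NormedSpace ℂ X] [SMul Aᵐᵒᵖ X] extends Inner A X where
  add_act (x y : X) (a : A) : (x + y) <• a = x <• a + y <• a
  act_add (x : X) (a b : A) : x <• (a + b) = x <• a + x <• b
  act_mul (x : X) (a b : A) : x <• (a * b) = x <• a <• b
  smul_act (c : ℂ) (x : X) (a : A) : (c • x) <• a = c • (x <• a)
  act_smul (c : ℂ) (x : X) (a : A) : x <• (c • a) = c • (x <• a)
  inner_self_nonneg (x : X) : 0 ≤ inner x x
  inner_self (x : X) : inner x x = 0 ↔ x = 0
  inner_add_right (x y z : X) : inner x (y + z) = inner x y + inner x z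
  inner_smul_right (c : ℂ) (x y : X) : inner x (c • y) = c • inner x y
  inner_act_right (x y : X) (a : A) : inner x (y <• a) = inner x y * a
  star_inner (x y : X) : star (inner x y) = inner y x
  norm_eq (x : X) : ‖x‖ = √‖inner x x‖

namespace HilbertModule

section

variable {A X : Type*} [NonUnitalCStarAlgebra A] [PartialOrder A]
  [NormedAddCommGroup X] [NormedSpace ℂ X] [SMul Aᵐᵒᵖ X] [HilbertModule A X]

local notation "⟪" x ", " y "⟫" => inner A x y

lemma norm_sq (x : X) : ‖x‖ ^ 2 = ‖⟪x, x⟫‖ := by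
  rw [norm_eq (A := A) x, Real.sq_sqrt (_root_.norm_nonneg _)]

lemma inner_add_left (x y z : X) : ⟪x + y, z⟫ = ⟪x, z⟫ + ⟪y, z⟫ := by
  rw [← star_inner z, inner_add_right, star_add, star_inner, star_inner]

lemma inner_smul_left (c : ℂ) (x y : X) : ⟪c • x, y⟫ = star c • ⟪x, y⟫ := by
  rw [← star_inner y, inner_smul_right, star_smul, star_inner]

lemma inner_act_left (x y : X) (a : A) : ⟪x <• a, y⟫ = star a * ⟪x, y⟫ := by
  rw [← star_inner y, inner_act_right, star_mul, star_inner]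

lemma inner_sub_right (x y z : X) : ⟪x, y - z⟫ = ⟪x, y⟫ - ⟪x, z⟫ := by
  have h := inner_add_right (A := A) x (y - z) z
  rw [sub_add_cancel] at h
  rw [h, add_sub_cancel_right]

lemma inner_sub_left (x y z : X) : ⟪x - y, z⟫ = ⟪x, z⟫ - ⟪y, z⟫ := by
  have h := inner_add_left (A := A) (x - y) y z
  rw [sub_add_cancel] at h
  rw [h, add_sub_cancel_right]

lemma ext_inner_left {x y : X} (h : ∀ z : X, ⟪z, x⟫ = ⟪z, y⟫) : x = y := by
  rw [← sub_eq_zero, ← inner_self (A := A), inner_sub_right, h, sub_self]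

lemma norm_act_le (x : X) (a : A) : ‖x <• a‖ ≤ ‖x‖ * ‖a‖ := by
  refine le_of_sq_le_sq ?_ (by positivity)
  rw [norm_sq (A := A), inner_act_left, inner_act_right, mul_pow, norm_sq (A := A) x]
  calc ‖star a * (⟪x, x⟫ * a)‖ ≤ ‖star a‖ * (‖⟪x, x⟫‖ * ‖a‖) :=
        (norm_mul_le _ _).trans (by gcongr; exact norm_mul_le _ _)
    _ = ‖⟪x, x⟫‖ * ‖a‖ ^ 2 := by rw [norm_star]; ring

lemma norm_inner_le [StarOrderedRing A] (x y : X) : ‖⟪x, y⟫‖ ≤ ‖x‖ * ‖y‖ := by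
  have : StarOrderedRing Aᵐᵒᵖ := .of_nonneg_iff' (fun h z => by
      rw [← MulOpposite.unop_le_unop] at h ⊢
      exact add_le_add_right h _) fun a => by
    rw [← MulOpposite.unop_le_unop, MulOpposite.unop_zero,
      CStarAlgebra.nonneg_iff_eq_mul_star_self]
    exact ⟨fun ⟨b, hb⟩ => ⟨.op b, MulOpposite.unop_injective hb⟩,
      fun ⟨b, hb⟩ => ⟨b.unop, by rw [hb]; rfl⟩⟩
  let _ : CStarModule Aᵐᵒᵖ X :=
    { inner := fun x y => MulOpposite.op ⟪x, y⟫
      inner_add_right := by intros; simp [inner_add_right]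
      inner_self_nonneg := by
        intro x
        exact MulOpposite.unop_le_unop.mp (inner_self_nonneg (A := A) x)
      inner_self := by intro x; simp [inner_self]
      inner_op_smul_right := by
        intro a x y
        obtain ⟨a, rfl⟩ := MulOpposite.op_surjective a
        rw [inner_act_right, MulOpposite.op_mul]
      inner_smul_right_complex := by intros; simp [inner_smul_right]
      star_inner := by intro x y; rw [← MulOpposite.op_star, star_inner]
      norm_eq_sqrt_norm_inner_self := by intro x; exact norm_eq (A := A) x }
  exact CStarModule.norm_inner_le (A := Aᵐᵒᵖ) X (x := x) (y := y)

variable (A X) in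
/-- The adjointable operators on `X`, as a subalgebra of the bounded operators on `X`. -/
def adjointableSubalgebra : Subalgebra ℂ (X →L[ℂ] X) where
  carrier := {T | ∃ S : X →L[ℂ] X, ∀ x y, ⟪T x, y⟫ = ⟪x, S y⟫}
  mul_mem' := by
    rintro T T' ⟨S, hS⟩ ⟨S', hS'⟩
    exact ⟨S' * S, fun x y => by simp [hS, hS']⟩
  add_mem' := by
    rintro T T' ⟨S, hS⟩ ⟨S', hS'⟩
    exact ⟨S + S', fun x y => by simp [hS, hS', inner_add_left, inner_add_right]⟩
  algebraMap_mem' c := ⟨star c • 1, fun x y => by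
    simp [Algebra.algebraMap_eq_smul_one, inner_smul_left, inner_smul_right]⟩

variable (A X) in
/-- `𝔹(X)`: the algebra of all adjointable operators on `X`, with the operator norm. -/
def Adjointable : Type _ := adjointableSubalgebra A X

namespace Adjointable

noncomputable instance : NormedRing (Adjointable A X) :=
  inferInstanceAs (NormedRing (adjointableSubalgebra A X))

noncomputable instance : NormedAlgebra ℂ (Adjointable A X) :=
  inferInstanceAs (NormedAlgebra ℂ (adjointableSubalgebra A X))

lemma isometry_val : Isometry fun T : Adjointable A X => (T.1 : X →L[ℂ] X) :=
  Isometry.of_dist_eq fun _ _ => rfl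

/-- The adjoint `T⋆` of an adjointable operator: `⟪T x, y⟫ = ⟪x, T⋆ y⟫`. -/
noncomputable instance : Star (Adjointable A X) where
  star T := ⟨T.2.choose, T.1, fun x y => by
    rw [← star_inner y, ← T.2.choose_spec y x, star_inner]⟩

lemma inner_left (T : Adjointable A X) (x y : X) : ⟪T.1 x, y⟫ = ⟪x, (star T).1 y⟫ :=
  T.2.choose_spec x y

lemma eq_star_of {T S : Adjointable A X} (h : ∀ x y, ⟪T.1 x, y⟫ = ⟪x, S.1 y⟫) :
    star T = S :=
  Subtype.ext <| ContinuousLinearMap.ext fun y => ext_inner_left (A := A) fun x => by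
    rw [← inner_left, h]

lemma inner_right (T : Adjointable A X) (x y : X) : ⟪(star T).1 x, y⟫ = ⟪x, T.1 y⟫ := by
  rw [← star_inner y, ← inner_left, star_inner]

noncomputable instance : StarRing (Adjointable A X) where
  star_involutive T := eq_star_of fun x y => inner_right T x y
  star_mul T S := eq_star_of fun x y => by
    change ⟪T.1 (S.1 x), y⟫ = ⟪x, (star S).1 ((star T).1 y)⟫
    rw [inner_left, inner_left]
  star_add T S := eq_star_of fun x y => by
    change ⟪T.1 x + S.1 x, y⟫ = ⟪x, (star T).1 y + (star S).1 y⟫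
    rw [inner_add_left, inner_add_right, inner_left, inner_left]

instance : StarModule ℂ (Adjointable A X) where
  star_smul c T := eq_star_of fun x y => by
    change ⟪c • T.1 x, y⟫ = ⟪x, star c • (star T).1 y⟫
    rw [inner_smul_left, inner_smul_right, inner_left]

variable [StarOrderedRing A]

instance : CStarRing (Adjointable A X) where
  norm_mul_self_le T := by
    have key : ∀ x, ‖T.1 x‖ ≤ √‖star T * T‖ * ‖x‖ := fun x => by
      refine le_of_sq_le_sq ?_ (by positivity)
      rw [norm_sq (A := A), inner_left, mul_pow, Real.sq_sqrt (_root_.norm_nonneg _)]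
      calc ‖⟪x, (star T).1 (T.1 x)⟫‖ ≤ ‖x‖ * ‖(star T * T).1 x‖ := norm_inner_le _ _
        _ ≤ ‖x‖ * (‖star T * T‖ * ‖x‖) := by
            gcongr; exact (star T * T).1.le_opNorm x
        _ = ‖star T * T‖ * ‖x‖ ^ 2 := by ring
    have h : ‖T‖ ≤ √‖star T * T‖ := T.1.opNorm_le_bound (by positivity) key
    calc ‖T‖ * ‖T‖ ≤ √‖star T * T‖ * √‖star T * T‖ := by gcongr
      _ = ‖star T * T‖ := Real.mul_self_sqrt (_root_.norm_nonneg _)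

variable [CompleteSpace X]

instance : CompleteSpace (Adjointable A X) := by
  refine Metric.complete_of_cauchySeq_tendsto fun u hu => ?_
  have hu' : CauchySeq fun n => star (u n) := by
    rw [Metric.cauchySeq_iff] at hu ⊢
    intro ε hε
    obtain ⟨N, hN⟩ := hu ε hε
    refine ⟨N, fun m hm n hn => ?_⟩
    rw [dist_eq_norm, ← star_sub, norm_star, ← dist_eq_norm]
    exact hN m hm n hn
  obtain ⟨T, hT⟩ := cauchySeq_tendsto_of_complete (isometry_val.uniformContinuous.comp_cauchySeq hu)
  obtain ⟨S, hS⟩ := cauchySeq_tendsto_of_complete (isometry_val.uniformContinuous.comp_cauchySeq hu')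
  have tends_right : ∀ (x : X) (v : ℕ → X) (y : X), Tendsto v atTop (𝓝 y) →
      Tendsto (fun n => ⟪x, v n⟫) atTop (𝓝 ⟪x, y⟫) := fun x v y hv => by
    rw [tendsto_iff_norm_sub_tendsto_zero] at hv ⊢
    refine squeeze_zero (fun _ => _root_.norm_nonneg _) (fun n => ?_)
      (by simpa using hv.const_mul ‖x‖)
    rw [← inner_sub_right]
    exact norm_inner_le _ _
  have hTS : ∀ x y, ⟪T x, y⟫ = ⟪x, S y⟫ := fun x y => by
    have h1 := (tends_right y _ _ (((ContinuousLinearMap.apply ℂ X x).continuous.tendsto T).comp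
      hT)).star
    have h2 := tends_right x _ _ (((ContinuousLinearMap.apply ℂ X y).continuous.tendsto S).comp
      hS)
    simp only [star_inner] at h1
    refine tendsto_nhds_unique h1 (h2.congr fun n => ?_)
    exact (inner_left (u n) x y).symm
  exact ⟨⟨T, S, hTS⟩, isometry_val.isEmbedding.tendsto_nhds_iff.mpr hT⟩

noncomputable instance : CStarAlgebra (Adjointable A X) where

end Adjointable

variable [StarOrderedRing A]

variable (A) in
/-- The operator `θ_{y,x} : z ↦ y ⟪x, z⟫` on `X`, whose adjoint is `θ_{x,y}`. -/
noncomputable def thetaOp (y x : X) : X →L[ℂ] X :=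
  LinearMap.mkContinuous
    { toFun := fun z => y <• ⟪x, z⟫
      map_add' := fun z w => by rw [inner_add_right, act_add]
      map_smul' := fun c z => by rw [inner_smul_right, act_smul, RingHom.id_apply] }
    (‖y‖ * ‖x‖) fun z => by
      calc ‖y <• ⟪x, z⟫‖ ≤ ‖y‖ * ‖⟪x, z⟫‖ := norm_act_le y _
        _ ≤ ‖y‖ * (‖x‖ * ‖z‖) := by gcongr; exact norm_inner_le _ _
        _ = ‖y‖ * ‖x‖ * ‖z‖ := by ring

lemma thetaOp_apply (y x z : X) : thetaOp A y x z = y <• ⟪x, z⟫ := rfl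

lemma inner_thetaOp (y x z w : X) : ⟪thetaOp A y x z, w⟫ = ⟪z, thetaOp A x y w⟫ := by
  rw [thetaOp_apply, thetaOp_apply, inner_act_left, inner_act_right, star_inner]

variable (A) in
/-- `θ_{y,x}` as an element of `𝔹(X)`. -/
noncomputable def thetaAdj (y x : X) : Adjointable A X :=
  ⟨thetaOp A y x, thetaOp A x y, inner_thetaOp y x⟩

lemma star_thetaAdj (y x : X) : star (thetaAdj A y x) = thetaAdj A x y :=
  Adjointable.eq_star_of (inner_thetaOp y x)

lemma mul_thetaAdj (T : Adjointable A X) (y x : X) :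
    T * thetaAdj A y x = thetaAdj A (T.1 y) x := by
  refine Subtype.ext <| ContinuousLinearMap.ext fun z => ext_inner_left (A := A) fun w => ?_
  change ⟪w, T.1 (y <• ⟪x, z⟫)⟫ = ⟪w, T.1 y <• ⟪x, z⟫⟫
  rw [← Adjointable.inner_right, inner_act_right, inner_act_right, Adjointable.inner_right]

variable (A X) in
/-- `𝔽(X)`: the "finite rank" operators, i.e. the linear span of all `θ_{y,x}`. -/
noncomputable def FiniteRank : NonUnitalStarSubalgebra ℂ (Adjointable A X) where
  toSubmodule := Submodule.span ℂ {T | ∃ y x : X, T = thetaAdj A y x}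
  mul_mem' := by
    intro T S _ hS
    change S ∈ Submodule.span ℂ _ at hS
    change T * S ∈ Submodule.span ℂ _
    induction hS using Submodule.span_induction with
    | mem S h =>
      obtain ⟨y, x, rfl⟩ := h
      exact Submodule.subset_span ⟨T.1 y, x, mul_thetaAdj T y x⟩
    | zero => rw [mul_zero]; exact Submodule.zero_mem _
    | add S S' _ _ h h' => rw [mul_add]; exact Submodule.add_mem _ h h'
    | smul c S _ h => rw [mul_smul_comm]; exact Submodule.smul_mem _ c h
  star_mem' := by
    intro S hS
    change S ∈ Submodule.span ℂ _ at hS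
    change star S ∈ Submodule.span ℂ _
    induction hS using Submodule.span_induction with
    | mem S h =>
      obtain ⟨y, x, rfl⟩ := h
      exact Submodule.subset_span ⟨x, y, star_thetaAdj y x⟩
    | zero => rw [star_zero]; exact Submodule.zero_mem _
    | add S S' _ _ h h' => rw [star_add]; exact Submodule.add_mem _ h h'
    | smul c S _ h => rw [star_smul]; exact Submodule.smul_mem _ _ h

variable (A X) in
/-- `𝕂(X)`: the C⋆-algebra of generalized compact operators, i.e. the norm closure of `𝔽(X)`. -/
noncomputable def Compacts [CompleteSpace X] : NonUnitalStarSubalgebra ℂ (Adjointable A X) :=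
  (FiniteRank A X).topologicalClosure

section Compacts

variable [CompleteSpace X]

noncomputable instance : NonUnitalCStarAlgebra (Compacts A X) :=
  NonUnitalStarSubalgebra.nonUnitalCStarAlgebra _
    (h_closed := NonUnitalStarSubalgebra.isClosed_topologicalClosure _)

/-- The usual order of a C⋆-algebra: `S ≤ T` iff `T - S` is selfadjoint with nonnegative
spectrum. -/
noncomputable instance : PartialOrder (Compacts A X) := CStarAlgebra.spectralOrder _

instance : StarOrderedRing (Compacts A X) := CStarAlgebra.spectralOrderedRing _

variable (A) in
/-- `θ_{y,x}` as an element of `𝕂(X)`. -/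
noncomputable def theta (y x : X) : Compacts A X :=
  ⟨thetaAdj A y x, NonUnitalStarSubalgebra.le_topologicalClosure _
    (Submodule.subset_span ⟨y, x, rfl⟩)⟩

end Compacts

variable (A) in
/-- A sequence `(x n)` in `X` is a Parseval frame if `∑ n, ⟪x, x n⟫ ⟪x n, x⟫ = ⟪x, x⟫`, with
convergence in norm, for all `x` in `X`. -/
def IsParsevalFrame (x : ℕ → X) : Prop :=
  ∀ z : X, Tendsto (fun N => ∑ n ∈ Finset.range N, ⟪z, x n⟫ * ⟪x n, z⟫) atTop (𝓝 ⟪z, z⟫)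

end

/-- An increasing (sequential) approximate unit `(e n)` of a C⋆-algebra `B`. -/
structure IsIncreasingApproxUnit {B : Type*} [NonUnitalCStarAlgebra B] [PartialOrder B]
    (e : ℕ → B) : Prop where
  nonneg (n : ℕ) : 0 ≤ e n
  norm_le_one (n : ℕ) : ‖e n‖ ≤ 1
  tendsto_mul (b : B) : Tendsto (fun n => e n * b) atTop (𝓝 b)
  monotone : Monotone e

/-- The relation between the sequence `(E N)` in `𝕂(X)`, the sequence `(x n)` in `X` and the
(strictly) increasing sequence `(p N)` of positive integers:
`∑_{n ≤ p N} θ_{x n, x n} ≤ E N` and `‖∑_{n ≤ p N} θ_{x n, x n} - E N‖ < 1 / N` for all `N ≥ 1`.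
All sequences are indexed from `0`, so that `E N`, `p N` and `x n` stand for the terms with
numbers `N + 1` and `n + 1`, and `Finset.range (p N)` picks the first `p N` terms of `x`. -/
structure Approximates {A X : Type*} [NonUnitalCStarAlgebra A] [PartialOrder A]
    [StarOrderedRing A] [NormedAddCommGroup X] [NormedSpace ℂ X] [CompleteSpace X]
    [SMul Aᵐᵒᵖ X] [HilbertModule A X] (E : ℕ → Compacts A X) (x : ℕ → X) (p : ℕ → ℕ) :
    Prop where
  pos (N : ℕ) : 0 < p N
  strictMono : StrictMono p
  sum_le (N : ℕ) : ∑ n ∈ Finset.range (p N), theta A (x n) (x n) ≤ E N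
  norm_lt (N : ℕ) : ‖∑ n ∈ Finset.range (p N), theta A (x n) (x n) - E N‖ < 1 / ((N : ℝ) + 1)

end HilbertModule

/-! ### Algebra and norm estimates for the operators θ_{y,x}. -/

namespace HilbertModule

variable {A X : Type*} [NonUnitalCStarAlgebra A] [PartialOrder A]
  [NormedAddCommGroup X] [NormedSpace ℂ X] [SMul Aᵐᵒᵖ X] [HilbertModule A X]

local notation "⟪" x ", " y "⟫" => inner A x y

/-! The core of (a) is that a positive `T` in 𝕂(X) is approximated from below by finite sums of
θ_{x,x} (`exists_sum_theta_le_norm_lt`). Write T = s² with s selfadjoint. If ∑ θ_{v,v} + r² = 1 in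
𝔹(X) with r selfadjoint and ‖rs‖ small, then s² - ∑ θ_{sv,sv} = s r² s = (rs)⋆(rs), which is
positive and small. Such v and r come from regularizing H = ∑ θ_{y,y}, where the y span the range of
a finite rank approximation of s as an A-module: conjugate H + t² by the inverse of a selfadjoint
square root. Since ∑_{n ≤ p N} θ_{x n,x n} ≤ E N ≤ E (N+1), the same approximation applies to the
difference E (N+1) - ∑ θ and extends the sequence inductively.

For (b), E N → 1 strongly, so the frame sums converge to ⟪z,z⟫ along `p`. They increase and are
bounded by ⟪z,z⟫, so the whole sequence converges in norm. -/

lemma inner_act_inner (y z w : X) : ⟪w, y <• ⟪y, z⟫⟫ = star ⟪y, w⟫ * ⟪y, z⟫ := by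
  rw [inner_act_right, star_inner]

lemma norm_apply_le (T : Adjointable A X) (x : X) : ‖T.1 x‖ ≤ ‖T‖ * ‖x‖ := T.1.le_opNorm x

variable [StarOrderedRing A]

lemma inner_thetaAdj_nonneg (y z : X) : 0 ≤ ⟪z, (thetaAdj A y y).1 z⟫ := by
  change 0 ≤ ⟪z, y <• ⟪y, z⟫⟫
  rw [inner_act_inner]
  exact star_mul_self_nonneg _

lemma thetaAdj_mul_star (T : Adjointable A X) (y x : X) :
    thetaAdj A y x * star T = thetaAdj A y (T.1 x) := by
  rw [← star_thetaAdj, ← star_mul, mul_thetaAdj, star_thetaAdj]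

/-- Since T θ_{y,y} T⋆ = θ_{Ty,Ty}, conjugation keeps the form ∑ θ_{y,y} and only moves the vectors.
-/
lemma mul_sum_thetaAdj_mul_star (T : Adjointable A X) (l : List X) :
    T * (l.map fun y => thetaAdj A y y).sum * star T =
      ((l.map T.1).map fun y => thetaAdj A y y).sum := by
  induction l with
  | nil => simp
  | cons y l ih =>
    simp only [List.map_cons, List.sum_cons]
    rw [mul_add, add_mul, ih, mul_thetaAdj, thetaAdj_mul_star]

lemma norm_thetaAdj_le (y x : X) : ‖thetaAdj A y x‖ ≤ ‖y‖ * ‖x‖ :=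
  (thetaOp A y x).opNorm_le_bound (by positivity) fun z =>
    calc ‖y <• ⟪x, z⟫‖ ≤ ‖y‖ * ‖⟪x, z⟫‖ := norm_act_le y _
      _ ≤ ‖y‖ * (‖x‖ * ‖z‖) := by gcongr; exact norm_inner_le _ _
      _ = ‖y‖ * ‖x‖ * ‖z‖ := by ring

/-- `‖θ_{y,y}‖ = ‖y‖²`; this is the nontrivial inequality. -/
lemma norm_sq_le_norm_thetaAdj (y : X) : ‖y‖ ^ 2 ≤ ‖thetaAdj A y y‖ := by
  rcases eq_or_ne y 0 with rfl | hy
  · simp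
  have hy : 0 < ‖y‖ := norm_pos_iff.mpr hy
  -- Testing θ_{y,y} on y itself gives ⟪y,y⟫², of norm ‖y‖⁴.
  have h1 : ‖⟪y, (thetaAdj A y y).1 y⟫‖ = ‖y‖ ^ 2 * ‖y‖ ^ 2 := by
    change ‖⟪y, y <• ⟪y, y⟫⟫‖ = _
    rw [inner_act_inner, CStarRing.norm_star_mul_self, norm_sq (A := A)]
  have h2 : ‖⟪y, (thetaAdj A y y).1 y⟫‖ ≤ ‖thetaAdj A y y‖ * ‖y‖ ^ 2 :=
    calc _ ≤ ‖y‖ * ‖(thetaAdj A y y).1 y‖ := norm_inner_le _ _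
      _ ≤ ‖y‖ * (‖thetaAdj A y y‖ * ‖y‖) := by gcongr; exact norm_apply_le _ _
      _ = _ := by ring
  rw [h1] at h2
  exact le_of_mul_le_mul_right h2 (by positivity)

/-- Left multiplication by `r` is controlled on a finite rank operator by the values of `r` at
finitely many vectors. -/
lemma exists_norm_mul_le_of_mem_finiteRank {G : Adjointable A X} (hG : G ∈ FiniteRank A X) :
    ∃ (l : List X) (C : ℝ), 0 ≤ C ∧ ∀ (r : Adjointable A X) (t : ℝ), 0 ≤ t →
      (∀ y ∈ l, ‖r.1 y‖ ≤ t) → ‖r * G‖ ≤ C * t := by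
  change G ∈ Submodule.span ℂ _ at hG
  induction hG using Submodule.span_induction with
  | mem G h =>
    obtain ⟨y, x, rfl⟩ := h
    refine ⟨[y], ‖x‖, norm_nonneg _, fun r t ht h => ?_⟩
    rw [mul_thetaAdj]
    calc _ ≤ ‖r.1 y‖ * ‖x‖ := norm_thetaAdj_le _ _
      _ ≤ t * ‖x‖ := by gcongr; exact h y (by simp)
      _ = _ := mul_comm _ _
  | zero => exact ⟨[], 0, le_rfl, fun r t _ _ => by simp⟩
  | add G G' _ _ h h' =>
    obtain ⟨l, C, hC, h⟩ := h
    obtain ⟨l', C', hC', h'⟩ := h'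
    refine ⟨l ++ l', C + C', by positivity, fun r t ht hr => ?_⟩
    rw [mul_add, add_mul]
    exact (norm_add_le _ _).trans (add_le_add
      (h r t ht fun y hy => hr y (by simp [hy])) (h' r t ht fun y hy => hr y (by simp [hy])))
  | smul c G _ h =>
    obtain ⟨l, C, hC, h⟩ := h
    refine ⟨l, ‖c‖ * C, by positivity, fun r t ht hr => ?_⟩
    rw [mul_smul_comm, norm_smul, mul_assoc]
    gcongr
    exact h r t ht hr

variable [CompleteSpace X]

/-! ### Positivity in 𝔹(X) and finite sums of θ_{v,v} close to the identity. -/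

section AdjointableOrder

/-- The usual order of the C⋆-algebra `𝔹(X)`. -/
noncomputable abbrev Adjointable.order : PartialOrder (Adjointable A X) :=
  CStarAlgebra.spectralOrder _

attribute [local instance] Adjointable.order

lemma Adjointable.starOrderedRing : StarOrderedRing (Adjointable A X) :=
  CStarAlgebra.spectralOrderedRing _

attribute [local instance] Adjointable.starOrderedRing

lemma inner_apply_nonneg {T : Adjointable A X} (hT : 0 ≤ T) (z : X) : 0 ≤ ⟪z, T.1 z⟫ := by
  obtain ⟨s, rfl⟩ := CStarAlgebra.nonneg_iff_eq_star_mul_self.mp hT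
  change 0 ≤ ⟪z, (star s).1 (s.1 z)⟫
  rw [← Adjointable.inner_left]
  exact inner_self_nonneg _

/-- A selfadjoint operator whose form is nonnegative is nonnegative. -/
lemma nonneg_of_inner_apply_nonneg {T : Adjointable A X} (hT : IsSelfAdjoint T)
    (h : ∀ z, 0 ≤ ⟪z, T.1 z⟫) : 0 ≤ T := by
  obtain ⟨s, hs, hss⟩ := CStarAlgebra.nonneg_iff_exists_isSelfAdjoint_and_eq_mul_self.mp
    (CFC.negPart_nonneg T)
  have hN : IsSelfAdjoint T⁻ := (CFC.negPart_nonneg T).isSelfAdjoint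
  -- As T⁻ T⁺ = 0, this product is -(T⁻)³ = -s⁶; its form is both nonnegative and nonpositive, which
  -- forces s³ = 0.
  have h1 : T⁻ * T * T⁻ = -(star (s ^ 3) * s ^ 3) := by
    have h0 : T⁻ * T = T⁻ * (T⁺ - T⁻) := by rw [CFC.posPart_sub_negPart T hT]
    rw [h0, mul_sub, CFC.negPart_mul_posPart, zero_sub, neg_mul, star_pow, hs.star_eq, hss]
    noncomm_ring
  have h2 : ∀ z, (s ^ 3).1 z = 0 := fun z => by
    have h3 := h (T⁻.1 z)
    have h4 : ⟪T⁻.1 z, T.1 (T⁻.1 z)⟫ = ⟪z, (T⁻ * T * T⁻).1 z⟫ := by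
      rw [Adjointable.inner_left, hN.star_eq]; rfl
    have h5 : ⟪z, (-(star (s ^ 3) * s ^ 3)).1 z⟫ = -⟪(s ^ 3).1 z, (s ^ 3).1 z⟫ := by
      change ⟪z, -((star (s ^ 3)).1 ((s ^ 3).1 z))⟫ = _
      rw [Adjointable.inner_left, ← neg_one_smul ℂ, inner_smul_right, neg_one_smul]
    rw [h4, h1, h5, Left.nonneg_neg_iff] at h3
    exact (inner_self _).mp (h3.antisymm (inner_self_nonneg _))
  have h3 : s ^ 3 = 0 := Subtype.ext (ContinuousLinearMap.ext h2)
  have h4 : T⁻ = 0 := by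
    rw [← norm_eq_zero, ← pow_eq_zero_iff two_ne_zero, sq, ← CStarRing.norm_star_mul_self,
      hN.star_eq, hss, show s * s * (s * s) = s ^ 3 * s by noncomm_ring, h3, zero_mul, norm_zero]
  rw [← CFC.posPart_sub_negPart T hT, h4, sub_zero]
  exact CFC.posPart_nonneg T

lemma thetaAdj_self_nonneg (y : X) : 0 ≤ thetaAdj A y y :=
  nonneg_of_inner_apply_nonneg (star_thetaAdj y y) (inner_thetaAdj_nonneg y)

lemma sum_thetaAdj_nonneg (l : List X) : 0 ≤ (l.map fun y => thetaAdj A y y).sum :=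
  List.sum_nonneg fun T hT => by
    obtain ⟨y, -, rfl⟩ := List.mem_map.mp hT
    exact thetaAdj_self_nonneg y

/-- If `∑ θ_{v,v} ≤ 1` then each `v` has norm at most `1`. -/
lemma norm_le_one_of_sum_thetaAdj_le_one {l : List X}
    (h : (l.map fun y => thetaAdj A y y).sum ≤ 1) {v : X} (hv : v ∈ l) : ‖v‖ ≤ 1 := by
  have h1 : thetaAdj A v v ≤ (l.map fun y => thetaAdj A y y).sum :=
    List.single_le_sum (fun T hT => by
      obtain ⟨y, -, rfl⟩ := List.mem_map.mp hT
      exact thetaAdj_self_nonneg y) _ (List.mem_map.mpr ⟨v, hv, rfl⟩)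
  have h2 := (CStarAlgebra.norm_le_one_iff_of_nonneg _ (thetaAdj_self_nonneg v)).mpr (h1.trans h)
  have := (norm_sq_le_norm_thetaAdj (A := A) v).trans h2
  exact (sq_le_one_iff₀ (norm_nonneg _)).mp this

/-- With H = ∑ θ_{y,y} over `l`, H + t² is invertible. If q is the inverse of a selfadjoint square
root of it, then qHq + (tq)² = 1 and qHq = ∑ θ_{qy,qy}. Each θ_{qy,qy} ≤ 1, so ‖qy‖ ≤ 1, and r = tq
satisfies ‖ry‖ ≤ t. -/
lemma exists_sum_thetaAdj_add_eq_one (l : List X) {t : ℝ} (ht : 0 < t) :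
    ∃ (l' : List X) (r : Adjointable A X), IsSelfAdjoint r ∧
      (l'.map fun y => thetaAdj A y y).sum + r * r = 1 ∧ ∀ y ∈ l, ‖r.1 y‖ ≤ t := by
  set H := (l.map fun y => thetaAdj A y y).sum with hH
  have hH0 : 0 ≤ H := sum_thetaAdj_nonneg l
  have ht' : (t : ℂ) ≠ 0 := by exact_mod_cast ht.ne'
  have hstar : star (t : ℂ) = t := by simp
  have hc : ((t : ℂ) * t) • (1 : Adjointable A X) =
      star ((t : ℂ) • (1 : Adjointable A X)) * ((t : ℂ) • 1) := by
    rw [star_smul, star_one, hstar, smul_mul_smul_comm, one_mul]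
  have hc0 : 0 ≤ ((t : ℂ) * t) • (1 : Adjointable A X) := by
    rw [hc]; exact star_mul_self_nonneg _
  have hcu : IsUnit (((t : ℂ) * t) • (1 : Adjointable A X)) :=
    (isUnit_one).smul (Units.mk0 _ (mul_ne_zero ht' ht'))
  have hK : IsUnit (H + ((t : ℂ) * t) • 1) :=
    CStarAlgebra.isUnit_of_le _ (le_add_of_nonneg_left hH0) (hcu.isStrictlyPositive hc0)
  obtain ⟨p, hp, hpp⟩ := CStarAlgebra.nonneg_iff_exists_isSelfAdjoint_and_eq_mul_self.mp
    (add_nonneg hH0 hc0)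
  rw [hpp, isUnit_mul_self_iff] at hK
  obtain ⟨u, rfl⟩ := hK
  set q : Adjointable A X := ↑(u⁻¹) with hqdef
  have hq : star q = q := by
    have : star u = u := Units.ext hp
    rw [hqdef, ← Units.coe_star, star_inv, this]
  have hFs : ((l.map q.1).map fun y => thetaAdj A y y).sum = q * H * q := by
    rw [hH, ← mul_sum_thetaAdj_mul_star, hq]
  have hF : ((l.map q.1).map fun y => thetaAdj A y y).sum +
      ((t : ℂ) • q) * ((t : ℂ) • q) = 1 := by
    have h1 : q * (H + ((t : ℂ) * t) • 1) * q = 1 := by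
      rw [hpp, ← mul_assoc, hqdef, Units.inv_mul, one_mul, Units.mul_inv]
    rw [hFs, ← h1, smul_mul_smul_comm, mul_add, add_mul, mul_smul_comm, mul_one, smul_mul_assoc]
  have hr : IsSelfAdjoint ((t : ℂ) • q) := by
    rw [IsSelfAdjoint, star_smul, hq, hstar]
  refine ⟨l.map q.1, (t : ℂ) • q, hr, hF, fun y hy => ?_⟩
  have h2 : ((l.map q.1).map fun y => thetaAdj A y y).sum ≤ 1 := by
    rw [← hF]
    refine le_add_of_nonneg_right ?_
    nth_rw 1 [← hr.star_eq]
    exact star_mul_self_nonneg _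
  have h3 : ‖q.1 y‖ ≤ 1 := norm_le_one_of_sum_thetaAdj_le_one h2 (List.mem_map_of_mem hy)
  change ‖(t : ℂ) • q.1 y‖ ≤ t
  rw [norm_smul, Complex.norm_real, Real.norm_of_nonneg ht.le]
  exact mul_le_of_le_one_right ht.le h3

/-- A finite rank G near s reduces smallness of rs to smallness of r on finitely many vectors; the
remainder r(s - G) is harmless because r² ≤ 1. -/
lemma exists_sum_thetaAdj_norm_mul_lt (s : Compacts A X) {ε : ℝ} (hε : 0 < ε) :
    ∃ (l : List X) (r : Adjointable A X), IsSelfAdjoint r ∧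
      (l.map fun y => thetaAdj A y y).sum + r * r = 1 ∧ ‖r * s.1‖ < ε := by
  have hs : s.1 ∈ closure (FiniteRank A X : Set (Adjointable A X)) := s.2
  obtain ⟨G, hG, hsG⟩ := Metric.mem_closure_iff.mp hs (ε / 2) (by positivity)
  obtain ⟨l, C, hC, h⟩ := exists_norm_mul_le_of_mem_finiteRank hG
  have hC1 : 0 < C + 1 := by positivity
  -- C + 1 replaces C in the denominator because C may vanish.
  obtain ⟨l', r, hr, hsum, hl⟩ := exists_sum_thetaAdj_add_eq_one (A := A) l
    (t := ε / 2 / (C + 1)) (by positivity)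
  refine ⟨l', r, hr, hsum, ?_⟩
  have hr0 : 0 ≤ r * r := by
    nth_rw 1 [← hr.star_eq]
    exact star_mul_self_nonneg _
  have hr1 : ‖r‖ ≤ 1 := by
    have : ‖r * r‖ ≤ 1 := (CStarAlgebra.norm_le_one_iff_of_nonneg _ hr0).mpr (by
      rw [← hsum]; exact le_add_of_nonneg_left (sum_thetaAdj_nonneg l'))
    nth_rw 1 [← hr.star_eq] at this
    rw [CStarRing.norm_star_mul_self, ← sq] at this
    exact (sq_le_one_iff₀ (norm_nonneg _)).mp this
  have h1 := h r _ (by positivity) hl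
  have h2 : C * (ε / 2 / (C + 1)) ≤ ε / 2 := by
    rw [mul_div_left_comm]
    exact mul_le_of_le_one_right (by positivity) ((div_le_one hC1).mpr (by linarith))
  rw [dist_eq_norm] at hsG
  calc ‖r * s.1‖ = ‖r * (s.1 - G) + r * G‖ := by rw [mul_sub, sub_add_cancel]
    _ ≤ ‖r‖ * ‖s.1 - G‖ + ‖r * G‖ :=
      (norm_add_le _ _).trans (by gcongr; exact norm_mul_le _ _)
    _ ≤ 1 * ‖s.1 - G‖ + ‖r * G‖ := by gcongr
    _ < ε := by linarith

end AdjointableOrder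

/-- `𝕂(X)` is a left ideal of `𝔹(X)`. -/
lemma mul_mem_compacts (T : Adjointable A X) (s : Compacts A X) : T * s.1 ∈ Compacts A X := by
  have hs : s.1 ∈ closure (FiniteRank A X : Set (Adjointable A X)) := s.2
  refine map_mem_closure (continuous_const_mul T) hs fun S hS => ?_
  change S ∈ Submodule.span ℂ _ at hS
  change T * S ∈ Submodule.span ℂ _
  induction hS using Submodule.span_induction with
  | mem S h =>
    obtain ⟨y, x, rfl⟩ := h
    exact Submodule.subset_span ⟨T.1 y, x, mul_thetaAdj T y x⟩
  | zero => rw [mul_zero]; exact Submodule.zero_mem _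
  | add S S' _ _ h h' => rw [mul_add]; exact Submodule.add_mem _ h h'
  | smul c S _ h => rw [mul_smul_comm]; exact Submodule.smul_mem _ c h

lemma coe_sum_theta (l : List X) :
    ((l.map fun y => theta A y y).sum : Compacts A X).1 = (l.map fun y => thetaAdj A y y).sum := by
  induction l with
  | nil => rfl
  | cons y l ih => rw [List.map_cons, List.sum_cons, List.map_cons, List.sum_cons, ← ih]; rfl

/-- Every nonnegative generalized compact operator is approximated from below by finite sums of
operators `θ_{x,x}`. -/
lemma exists_sum_theta_le_norm_lt {T : Compacts A X} (hT : 0 ≤ T) {ε : ℝ} (hε : 0 < ε) :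
    ∃ l : List X, (l.map fun y => theta A y y).sum ≤ T ∧
      ‖(l.map fun y => theta A y y).sum - T‖ < ε := by
  obtain ⟨s, hs, rfl⟩ := CStarAlgebra.nonneg_iff_exists_isSelfAdjoint_and_eq_mul_self.mp hT
  obtain ⟨l, r, hr, hsum, hrs⟩ := exists_sum_thetaAdj_norm_mul_lt s (Real.sqrt_pos.mpr hε)
  set a : Compacts A X := ⟨r * s.1, mul_mem_compacts r s⟩ with ha
  have hs' : star s.1 = s.1 := congrArg Subtype.val hs
  have key : s * s - ((l.map s.1.1).map fun y => theta A y y).sum = star a * a := by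
    apply Subtype.ext
    change s.1 * s.1 - Subtype.val _ = star (r * s.1) * (r * s.1)
    have h1 : ((l.map s.1.1).map fun y => thetaAdj A y y).sum =
        s.1 * (l.map fun y => thetaAdj A y y).sum * s.1 := by
      rw [← mul_sum_thetaAdj_mul_star, hs']
    rw [coe_sum_theta, h1, eq_sub_of_add_eq hsum, star_mul, hr.star_eq, hs']
    noncomm_ring
  refine ⟨l.map s.1.1, ?_, ?_⟩
  · rw [← sub_nonneg, key]
    exact star_mul_self_nonneg a
  · rw [norm_sub_rev, key, CStarRing.norm_star_mul_self]
    have : ‖a‖ < √ε := hrs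
    calc ‖a‖ * ‖a‖ < √ε * √ε := by gcongr
      _ = ε := Real.mul_self_sqrt hε.le

end HilbertModule
-- Strong convergence, the Parseval identity and the inductive choice of vectors.
namespace HilbertModule

variable {A X : Type*} [NonUnitalCStarAlgebra A] [PartialOrder A] [StarOrderedRing A]
  [NormedAddCommGroup X] [NormedSpace ℂ X] [SMul Aᵐᵒᵖ X] [HilbertModule A X] [CompleteSpace X]

local notation "⟪" x ", " y "⟫" => inner A x y

lemma inner_coe_nonneg {T : Compacts A X} (hT : 0 ≤ T) (z : X) : 0 ≤ ⟪z, T.1.1 z⟫ := by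
  obtain ⟨s, rfl⟩ := CStarAlgebra.nonneg_iff_eq_star_mul_self.mp hT
  change 0 ≤ ⟪z, (star s.1).1 (s.1.1 z)⟫
  rw [← Adjointable.inner_left]
  exact inner_self_nonneg _

lemma inner_coe_mono {S T : Compacts A X} (h : S ≤ T) (z : X) :
    ⟪z, S.1.1 z⟫ ≤ ⟪z, T.1.1 z⟫ := by
  have := inner_coe_nonneg (sub_nonneg.mpr h) z
  rw [← sub_nonneg, ← inner_sub_right]
  exact this

/-- The comparison T ≤ 1 is made in 𝔹(X), since the identity need not lie in 𝕂(X). -/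
lemma inner_coe_le_inner_self {T : Compacts A X} (hT : 0 ≤ T) (hT1 : ‖T‖ ≤ 1) (z : X) :
    ⟪z, T.1.1 z⟫ ≤ ⟪z, z⟫ := by
  obtain ⟨s, rfl⟩ := CStarAlgebra.nonneg_iff_eq_star_mul_self.mp hT
  let := Adjointable.order (A := A) (X := X)
  have := Adjointable.starOrderedRing (A := A) (X := X)
  have h := inner_apply_nonneg (sub_nonneg.mpr <|
    (CStarAlgebra.norm_le_one_iff_of_nonneg (star s.1 * s.1) (star_mul_self_nonneg _)).mp hT1) z
  rw [← sub_nonneg, ← inner_sub_right]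
  exact h

/-- An approximate unit of `𝕂(X)` converges strongly to the identity of `X`. -/
lemma IsIncreasingApproxUnit.tendsto_apply {E : ℕ → Compacts A X}
    (hE : IsIncreasingApproxUnit E) (z : X) :
    Tendsto (fun N => (E N).1.1 z) atTop (𝓝 z) := by
  have h1 := (tendsto_iff_norm_sub_tendsto_zero.mp (hE.tendsto_mul (theta A z z))).mul_const 2
  rw [zero_mul] at h1
  -- With w = (E N - 1)z, θ_{w,w} = (E N - 1) θ_{z,z} (E N - 1) has norm at least ‖w‖². The left
  -- product tends to 0 and the last factor has norm at most 2.
  have h2 : ∀ N, ‖(E N).1.1 z - z‖ ^ 2 ≤ ‖E N * theta A z z - theta A z z‖ * 2 := fun N => by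
    have hsa : star (E N).1 = (E N).1 := congrArg Subtype.val (hE.nonneg N).isSelfAdjoint
    have hw : ((E N).1 - 1).1 z = (E N).1.1 z - z := rfl
    have h3 : ‖(E N).1 - 1‖ ≤ 2 := by
      have h4 : ‖(1 : Adjointable A X)‖ ≤ 1 := ContinuousLinearMap.norm_id_le
      have h5 : ‖(E N).1‖ ≤ 1 := hE.norm_le_one N
      linarith [norm_sub_le (E N).1 1]
    calc ‖(E N).1.1 z - z‖ ^ 2
        ≤ ‖thetaAdj A (((E N).1 - 1).1 z) (((E N).1 - 1).1 z)‖ := norm_sq_le_norm_thetaAdj _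
      _ = ‖((E N).1 * thetaAdj A z z - thetaAdj A z z) * ((E N).1 - 1)‖ := by
          rw [← thetaAdj_mul_star, ← mul_thetaAdj, star_sub, star_one, hsa, sub_one_mul]
      _ ≤ ‖(E N).1 * thetaAdj A z z - thetaAdj A z z‖ * ‖(E N).1 - 1‖ := norm_mul_le _ _
      _ ≤ ‖E N * theta A z z - theta A z z‖ * 2 := by gcongr; exact le_rfl
  have h3 := squeeze_zero (fun N => sq_nonneg _) h2 h1
  rw [tendsto_iff_norm_sub_tendsto_zero]
  simpa [Real.sqrt_sq (norm_nonneg _)] using h3.sqrt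

lemma inner_sum_theta_apply (x : ℕ → X) (M : ℕ) (z : X) :
    ⟪z, (∑ n ∈ Finset.range M, theta A (x n) (x n)).1.1 z⟫ =
      ∑ n ∈ Finset.range M, ⟪z, x n⟫ * ⟪x n, z⟫ := by
  induction M with
  | zero =>
    change ⟪z, (0 : X)⟫ = 0
    simpa using inner_sub_right (A := A) z 0 0
  | succ M ih =>
    rw [Finset.sum_range_succ, Finset.sum_range_succ, ← ih, ← inner_act_right, ← inner_add_right]
    rfl

lemma Approximates.tendsto_apply {E : ℕ → Compacts A X} (hE : IsIncreasingApproxUnit E)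
    {x : ℕ → X} {p : ℕ → ℕ} (h : Approximates E x p) (z : X) :
    Tendsto (fun N => (∑ n ∈ Finset.range (p N), theta A (x n) (x n)).1.1 z) atTop (𝓝 z) := by
  have h1 : Tendsto
      (fun N => (∑ n ∈ Finset.range (p N), theta A (x n) (x n) - E N).1.1 z) atTop (𝓝 0) := by
    refine squeeze_zero_norm (fun N => ?_)
      (by simpa using tendsto_one_div_add_atTop_nhds_zero_nat (𝕜 := ℝ) |>.mul_const ‖z‖)
    exact (norm_apply_le _ z).trans (by gcongr; simpa using (h.norm_lt N).le)
  have h2 := h1.add (hE.tendsto_apply z)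
  rw [zero_add] at h2
  refine h2.congr fun N => ?_
  exact sub_add_cancel ((∑ n ∈ Finset.range (p N), theta A (x n) (x n)).1.1 z) _

lemma Approximates.isParsevalFrame {E : ℕ → Compacts A X} (hE : IsIncreasingApproxUnit E)
    {x : ℕ → X} {p : ℕ → ℕ} (h : Approximates E x p) : IsParsevalFrame A x := by
  intro z
  set f : ℕ → A := fun M => ∑ n ∈ Finset.range M, ⟪z, x n⟫ * ⟪x n, z⟫ with hf
  have hmono : Monotone f := monotone_nat_of_le_succ fun M => by
    simp only [hf]
    rw [Finset.sum_range_succ, ← star_inner (x M) z]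
    exact le_add_of_nonneg_right (star_mul_self_nonneg _)
  have hle : ∀ M, f M ≤ ⟪z, z⟫ := fun M => by
    -- Strict monotonicity gives M ≤ p M, so f M ≤ f (p M).
    refine (hmono h.strictMono.le_apply).trans ?_
    simp only [hf]
    rw [← inner_sum_theta_apply]
    exact (inner_coe_mono (h.sum_le M) z).trans
      (inner_coe_le_inner_self (hE.nonneg M) (hE.norm_le_one M) z)
  have hsub : Tendsto (fun N => ‖⟪z, z⟫ - f (p N)‖) atTop (𝓝 0) := by
    have h1 := (tendsto_iff_norm_sub_tendsto_zero.mp (h.tendsto_apply hE z)).const_mul ‖z‖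
    rw [mul_zero] at h1
    refine squeeze_zero (fun _ => norm_nonneg _) (fun N => ?_) h1
    simp only [hf]
    rw [← inner_sum_theta_apply, norm_sub_rev, ← inner_sub_right]
    exact norm_inner_le _ _
  rw [Metric.tendsto_atTop] at hsub ⊢
  intro ε hε
  obtain ⟨N, hN⟩ := hsub ε hε
  refine ⟨p N, fun M hM => ?_⟩
  have h1 := hN N le_rfl
  rw [Real.dist_0_eq_abs, abs_norm] at h1
  rw [dist_eq_norm, norm_sub_rev]
  -- For M ≥ p N, 0 ≤ ⟪z,z⟫ - f M ≤ ⟪z,z⟫ - f (p N), and the norm is monotone on positive elements.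
  exact (CStarAlgebra.norm_le_norm_of_nonneg_of_le (sub_nonneg.mpr (hle M))
    (sub_le_sub_left (hmono hM) _)).trans_lt h1

/-- Finite lists of vectors that approximate the `E N` from below, each a proper prefix of
the next. -/
lemma exists_seq_list_approximates {E : ℕ → Compacts A X} (hE : IsIncreasingApproxUnit E) :
    ∃ L : ℕ → List X, (∀ N, L N <+: L (N + 1)) ∧ (∀ N, (L N).length < (L (N + 1)).length) ∧
      (∀ N, 0 < (L N).length) ∧ (∀ N, ((L N).map fun y => theta A y y).sum ≤ E N) ∧
      ∀ N, ‖((L N).map fun y => theta A y y).sum - E N‖ < 1 / ((N : ℝ) + 1) := by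
  have extend : ∀ (l : List X) (T : Compacts A X) (N : ℕ),
      (l.map fun y => theta A y y).sum ≤ T → ∃ l' : List X, l <+: l' ∧ l.length < l'.length ∧
        (l'.map fun y => theta A y y).sum ≤ T ∧
        ‖(l'.map fun y => theta A y y).sum - T‖ < 1 / ((N : ℝ) + 1) := fun l T N h => by
    obtain ⟨m, hm, hm'⟩ := exists_sum_theta_le_norm_lt (sub_nonneg.mpr h)
      (Nat.one_div_pos_of_nat (α := ℝ) (n := N))
    have h0 : theta A (0 : X) 0 = 0 := by
      apply Subtype.ext
      have := norm_thetaAdj_le (A := A) (0 : X) 0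
      rw [norm_zero, zero_mul] at this
      exact norm_le_zero_iff.mp this
    -- The extra zero vector contributes nothing to the sum but makes the list strictly longer even
    -- when `m` is empty, as strict growth of `p` requires.
    refine ⟨l ++ 0 :: m, List.prefix_append _ _, by simp, ?_, ?_⟩
    · simp only [List.map_append, List.map_cons, List.sum_append, List.sum_cons, h0, zero_add]
      exact le_sub_iff_add_le'.mp hm
    · simp only [List.map_append, List.map_cons, List.sum_append, List.sum_cons, h0, zero_add]
      rwa [add_comm, ← sub_sub_eq_add_sub]
  choose! g hg1 hg2 hg3 hg4 using extend
  have hnil : (([] : List X).map fun y => theta A y y).sum ≤ E 0 := by simpa using hE.nonneg 0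
  let L : ℕ → List X := fun N => N.rec (g [] (E 0) 0) fun N l => g l (E (N + 1)) (N + 1)
  have hL : ∀ N, ((L N).map fun y => theta A y y).sum ≤ E N := fun N => by
    induction N with
    | zero => exact hg3 _ _ _ hnil
    | succ N ih => exact hg3 _ _ _ (ih.trans (hE.monotone N.le_succ))
  have hL' : ∀ N, ((L N).map fun y => theta A y y).sum ≤ E (N + 1) :=
    fun N => (hL N).trans (hE.monotone N.le_succ)
  have hlen : ∀ N, (L N).length < (L (N + 1)).length := fun N => hg2 _ _ _ (hL' N)
  refine ⟨L, fun N => hg1 _ _ _ (hL' N), hlen, fun N => ?_, hL, fun N => ?_⟩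
  · cases N with
    | zero => exact hg2 _ _ _ hnil
    | succ N => exact (Nat.zero_le _).trans_lt (hlen N)
  · cases N with
    | zero => exact hg4 _ _ _ hnil
    | succ N => exact hg4 _ _ _ (hL' N)

lemma exists_approximates {E : ℕ → Compacts A X} (hE : IsIncreasingApproxUnit E) :
    ∃ (x : ℕ → X) (p : ℕ → ℕ), Approximates E x p := by
  obtain ⟨L, hpre, hlen, hpos, hle, hlt⟩ := exists_seq_list_approximates hE
  have hstrict : StrictMono fun N => (L N).length := strictMono_nat_of_lt_succ hlen
  have hpre' : ∀ {M N}, M ≤ N → L M <+: L N := fun {M N} h => by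
    induction N, h using Nat.le_induction with
    | base => exact List.prefix_rfl
    | succ N _ ih => exact ih.trans (hpre N)
  -- Hence entry n exists in `L n`; by the prefix property it is also entry n of every `L N` long
  -- enough to have one, so the lists glue to one sequence.
  have hn : ∀ n, n < (L n).length := fun n => by
    induction n with
    | zero => exact hpos 0
    | succ n ih => exact lt_of_le_of_lt ih (hlen n)
  have hsum : ∀ N, ∑ n ∈ Finset.range (L N).length, theta A ((L n)[n]'(hn n)) ((L n)[n]'(hn n)) =
      ((L N).map fun y => theta A y y).sum := fun N => by
    rw [Finset.sum_range, ← Fin.sum_univ_getElem (((L N).map fun y => theta A y y))]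
    refine Fintype.sum_equiv (finCongr (by simp)) _ _ fun i => ?_
    have : (L i)[(i : ℕ)]'(hn i) = (L N)[(i : ℕ)] := by
      rcases le_total (i : ℕ) N with h | h
      · exact (hpre' h).getElem (hn i)
      · exact ((hpre' h).getElem i.2).symm
    simp [this]
  refine ⟨fun n => (L n)[n]'(hn n), fun N => (L N).length, hpos, hstrict, fun N => ?_, fun N => ?_⟩
  · rw [hsum]; exact hle N
  · rw [hsum]; exact hlt N

end HilbertModule

theorem theorem2p8 {A X : Type*} [NonUnitalCStarAlgebra A] [PartialOrder A] [StarOrderedRing A]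
    [NormedAddCommGroup X] [NormedSpace ℂ X] [CompleteSpace X] [SMul Aᵐᵒᵖ X] [HilbertModule A X]
    (E : ℕ → HilbertModule.Compacts A X) (hE : HilbertModule.IsIncreasingApproxUnit E) :
    (∃ (x : ℕ → X) (p : ℕ → ℕ), HilbertModule.Approximates E x p) ∧
      ∀ (x : ℕ → X) (p : ℕ → ℕ), HilbertModule.Approximates E x p →
        HilbertModule.IsParsevalFrame A x := by
  exact ⟨HilbertModule.exists_approximates hE, fun _ _ h => h.isParsevalFrame hE⟩
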